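/- Let $n\ge 1$ and let $\mathcal C=\{c\in\mathbb N_0^n : \sum_{i=1}^n c_i=n\}$ be the set of configurations of $n$ nodes, where $c_i$ is the number of nodes supporting color $i$; the remaining colors of $c$ are the $i$ with $c_i>0$. For a function $\alpha$ that assigns to each $c\in\mathcal C$ a probability vector $\alpha(c)\in[0,1]^n$, let $P_\alpha$ be the Markov chain on $\mathcal C$ in which, from configuration $c$, each of the $n$ nodes independently adopts color $i$ with probability $\alpha_i(c)$ (so the next configuration has law $\mathrm{Mult}(n,\alpha(c))$). Voter is $P_{\alpha^{V}}$, where $\alpha^{V}_i(c)=c_i/n$ is the probability that a uniformly random node has color $i$. 3-Majority is $P_{\alpha^{3M}}$, where $\alpha^{3M}_i(c)$ is the probability of adopting color $i$ under the following rule: sample three nodes independently and uniformly at random; if some color is supported by at least two of the samples, adopt it; otherwise adopt the color of one of the three samples chosen uniformly at random. (Explicitly, $\alpha^{3M}_i(c)=\frac{c_i}{n}\bigl(1+\frac{c_i}{n}-\sum_{j}\frac{c_j^2}{n^2}\bigr)$.) For $\kappa\in\{1,2,\dots\}$ let $T^\kappa_{P}(c)\in\mathbb N_0\cup\{\infty\}$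 be the first time step at which the process $P$, started from $c$ at time $0$, has at most $\kappa$ remaining colors. For random variables $X,Y$ write $X\le^{\mathrm{st}}Y$ if $\Pr[X\ge x]\le\Pr[Y\ge x]$ for all $x\in\mathbb N_0$. For $x,y\in\mathbb R^n$ write $x\succeq y$ if $\sum_i x_i=\sum_i y_i$ and, for every $l\in\{1,\dots,n\}$, the sum of the $l$ largest components of $x$ is at least the sum of the $l$ largest components of $y$. **Lemma.** For every $c\in\mathcal C$: 1. There is a coupling of the trajectories of Voter and 3-Majority, both started from $c$, under which, almost surely, after every round the number of remaining colors in Voter is not smaller than the number of remaining colors in 3-Majority. 2. $T^\kappa_{3M}(c)\le^{\mathrm{st}}T^\kappa_{V}(c)$ for every $\kappa\in\{1,2,\dots\}$. Moreover, for all $c,\tilde c\in\mathcal C$ with $c\succeq\tilde c$ we have $\alpha^{3M}(c)\succeq\alpha^{V}(\tilde c)$. -/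

import Mathlib

open MeasureTheory ProbabilityTheory
open scoped ENNReal

namespace Consensus

/-- Configurations of `n` nodes: `c i` is the number of nodes that support color `i`. -/
def Config (n : ℕ) : Type := {c : Fin n → ℕ // ∑ i, c i = n}

namespace Config

variable {n : ℕ}

instance : CoeFun (Config n) (fun _ => Fin n → ℕ) := ⟨Subtype.val⟩

instance : Countable (Config n) :=
  inferInstanceAs (Countable {c : Fin n → ℕ // ∑ i, c i = n})

instance : MeasurableSpace (Config n) := ⊤

instance : DiscreteMeasurableSpace (Config n) := ⟨fun _ => trivial⟩

/-- The number of remaining colors. -/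
def numColors (c : Config n) : ℕ := (Finset.univ.filter fun i => 0 < c i).card

/-- The configuration in which node `v` supports color `o v`. -/
def ofOpinions (o : Fin n → Fin n) : Config n :=
  ⟨fun i => (Finset.univ.filter fun v => o v = i).card, by
    have h := Finset.card_eq_sum_card_fiberwise (f := o) (s := Finset.univ)
      (t := Finset.univ) (fun _ _ => Finset.mem_coe.2 (Finset.mem_univ _))
    rw [← h, Finset.card_univ, Fintype.card_fin]⟩

end Config

/-! ### Majorization -/

/-- The components of `x` in non-increasing order. -/
noncomputable def sortDown {d : ℕ} (x : Fin d → ℝ) : Fin d → ℝ :=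
  fun i => x (Tuple.sort x (Fin.rev i))

/-- `Majorizes x y` is `x ⪰ y`. -/
def Majorizes {d : ℕ} (x y : Fin d → ℝ) : Prop :=
  (∀ l : ℕ, 1 ≤ l → l ≤ d →
    ∑ i ∈ Finset.univ.filter (fun i : Fin d => (i : ℕ) < l), sortDown y i ≤
      ∑ i ∈ Finset.univ.filter (fun i : Fin d => (i : ℕ) < l), sortDown x i) ∧
    ∑ i, x i = ∑ i, y i

/-! ### Anonymous consensus processes -/

/-- A process function: in configuration `c`, each node independently adopts color `i` with
probability `α c i`. -/
abbrev ProcessFunction (n : ℕ) : Type := Config n → PMF (Fin n)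

namespace ProcessFunction

variable {n : ℕ}

/-- The vector of adoption probabilities in configuration `c`, as real numbers. -/
noncomputable def probVec (α : ProcessFunction n) (c : Config n) : Fin n → ℝ :=
  fun i => (α c i).toReal

/-- One round: every one of the `n` nodes independently draws its new color from `α c`.
The resulting configuration thus has the multinomial law `Mult(n, α c)`. -/
noncomputable def step (α : ProcessFunction n) : Kernel (Config n) (Config n) :=
  Kernel.ofFunOfCountable fun c =>
    (Measure.pi fun _ : Fin n => (α c).toMeasure).map Config.ofOpinions

instance (α : ProcessFunction n) : IsMarkovKernel (step α) :=
  ⟨fun _ => Measure.isProbabilityMeasure_map (Measurable.of_discrete.aemeasurable)⟩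

/-- The one-step kernel of the process, reading only the last entry of the history. -/
noncomputable def historyStep (α : ProcessFunction n) (t : ℕ) :
    Kernel ((_ : Finset.Iic t) → Config n) (Config n) :=
  (step α).comap (fun h => h ⟨t, Finset.mem_Iic.2 le_rfl⟩) (measurable_pi_apply _)

instance (α : ProcessFunction n) (t : ℕ) : IsMarkovKernel (historyStep α t) :=
  inferInstanceAs (IsMarkovKernel (Kernel.comap _ _ _))

/-- The law, on the space of trajectories, of the Markov chain with transition kernel `step α`
started at time `0` in configuration `c`. -/
noncomputable def law (α : ProcessFunction n) (c : Config n) : Measure (ℕ → Config n) :=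
  Kernel.traj (X := fun _ => Config n) (historyStep α) 0 (fun _ => c)

end ProcessFunction

/-- The first time step at which at most `κ` colors remain (`⊤` if there is none). -/
noncomputable def hitTime {n : ℕ} (κ : ℕ) (p : ℕ → Config n) : ℕ∞ :=
  ⨅ (t : ℕ) (_ : (p t).numColors ≤ κ), (t : ℕ∞)

/-- `X ≤ˢᵗ Y`, for `X` defined on `(Ω, μ)` and `Y` defined on `(Ω', ν)`. -/
def StochLE {Ω Ω' : Type*} [MeasurableSpace Ω] [MeasurableSpace Ω']
    (μ : Measure Ω) (X : Ω → ℕ∞) (ν : Measure Ω') (Y : Ω' → ℕ∞) : Prop :=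
  ∀ x : ℕ, μ {ω | (x : ℕ∞) ≤ X ω} ≤ ν {ω | (x : ℕ∞) ≤ Y ω}

/-- `γ` is a coupling of `μ` and `ν`. -/
def IsCoupling {Ω Ω' : Type*} [MeasurableSpace Ω] [MeasurableSpace Ω']
    (γ : Measure (Ω × Ω')) (μ : Measure Ω) (ν : Measure Ω') : Prop :=
  γ.map Prod.fst = μ ∧ γ.map Prod.snd = ν

/-! ### Voter and 3-Majority -/

variable {n : ℕ}

/-- Voter: adopt the color of a uniformly random node; this color is `i` with probability
`c i / n`. -/
noncomputable def voter [NeZero n] : ProcessFunction n := fun c =>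
  PMF.ofFintype (fun i => (c i : ℝ≥0∞) / (n : ℝ≥0∞)) (by
    simp only [div_eq_mul_inv]
    rw [← Finset.sum_mul, ← Nat.cast_sum, c.2]
    exact ENNReal.mul_inv_cancel (Nat.cast_ne_zero.2 (NeZero.ne n)) (ENNReal.natCast_ne_top n))

/-- The color adopted by a node whose three samples have colors `a₁`, `a₂`, `a₃`: a color seen
at least twice if there is one, otherwise a uniformly random one of the three. -/
noncomputable def majorityRule (a₁ a₂ a₃ : Fin n) : PMF (Fin n) :=
  if a₁ = a₂ ∨ a₁ = a₃ then PMF.pure a₁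
  else if a₂ = a₃ then PMF.pure a₂
  else PMF.uniformOfFinset {a₁, a₂, a₃} (Finset.insert_nonempty _ _)

/-- 3-Majority: apply the majority rule to the colors of three independent uniformly random
nodes (the color of one uniformly random node has law `voter c`). -/
noncomputable def threeMajority [NeZero n] : ProcessFunction n := fun c =>
  (voter c).bind fun a₁ => (voter c).bind fun a₂ => (voter c).bind fun a₃ =>
    majorityRule a₁ a₂ a₃

end Consensus

/-! The core is a coupling statement: if the vector `x` majorizes `y`, then `Mult(n, x)` and
`Mult(n, y)` can be coupled so that the first count vector almost surely majorizes the second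
(`dominates_pow_of_setMajorizes`). A multinomial law is read off the coefficients of the `n`-th
power of a linear form, so it suffices to transport coefficients of polynomials along majorization
of exponents (`Dominates`). Up to permutations, `y` arises from `x` by transfers from a larger
component `i` to a smaller component `j` that keep their order (`dominates_pow_of_prefix_sums`). For
one transfer, `y` is a convex combination of `x` and its symmetrization `u` in `i` and `j`, and
factors of the power are exchanged one at a time. The cofactor of an exchanged factor splits into a
part symmetric in `i` and `j`, where swapping variables does the job, and a part whose exponents
favour `i`, where a unit at `i` is moved to `j` (`dominates_linearForm_averageSwap`).

The adoption vector of 3-Majority at `c` majorizes that of Voter at `c`, which is linear in `c`;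
hence majorization of configurations passes to adoption vectors, and by the coupling to the next
configurations. Iterating the one-round coupling gives trajectories that stay majorized forever
(`exists_isCoupling_law`). A majorizing configuration has at most as many colors, which yields the
comparison of color counts and of hitting times. -/

namespace Consensus

/-! ### Transport of weights along a relation -/

/-- `F` and `G` are the marginals of a weight on pairs that is supported on the relation `R`. -/
def Transports {A : Type*} (R : A → A → Prop) (F G : A → ℝ≥0∞) : Prop :=
  ∃ γ : A → A → ℝ≥0∞, (∀ a b, γ a b ≠ 0 → R a b) ∧ (∀ a, ∑' b, γ a b = F a) ∧
    ∀ b, ∑' a, γ a b = G b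

namespace Transports

variable {A : Type*} {R : A → A → Prop} {F G H F' G' : A → ℝ≥0∞}

lemma add (h : Transports R F G) (h' : Transports R F' G') : Transports R (F + F') (G + G') := by
  obtain ⟨γ, h1, h2, h3⟩ := h
  obtain ⟨γ', h1', h2', h3'⟩ := h'
  refine ⟨fun a b => γ a b + γ' a b, fun a b hab => ?_, fun a => ?_, fun b => ?_⟩
  · by_cases h0 : γ a b = 0
    · exact h1' a b fun h => hab (by simp [h0, h])
    · exact h1 a b h0
  · simp [ENNReal.tsum_add, h2, h2']
  · simp [ENNReal.tsum_add, h3, h3']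

lemma smul (r : ℝ≥0∞) (h : Transports R F G) : Transports R (r • F) (r • G) := by
  obtain ⟨γ, h1, h2, h3⟩ := h
  refine ⟨fun a b => r * γ a b, fun a b hab => h1 a b (right_ne_zero_of_mul hab), fun a => ?_,
    fun b => ?_⟩
  · simp [ENNReal.tsum_mul_left, h2]
  · simp [ENNReal.tsum_mul_left, h3]

lemma of_equiv (e : A ≃ A) (he : ∀ a, R a (e a)) : Transports R F fun b => F (e.symm b) := by
  classical
  refine ⟨fun a b => if b = e a then F a else 0, fun a b hab => ?_, fun a => ?_, fun b => ?_⟩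
  · by_cases h : b = e a
    · exact h ▸ he a
    · simp [h] at hab
  · exact tsum_ite_eq _ _
  · rw [tsum_eq_single (e.symm b)]
    · simp
    · intro a ha
      refine if_neg ?_
      rintro rfl
      exact ha (by simp)

/-- Gluing: the two transports are composed conditionally independently given the middle point, with
weight `γ a b * γ' b c / G b`. Where `G b = 0` both factors vanish, so the quotient does no harm. -/
lemma trans (hR : ∀ a b c, R a b → R b c → R a c) (hG : ∀ a, G a ≠ ∞)
    (h : Transports R F G) (h' : Transports R G H) : Transports R F H := by
  obtain ⟨γ, h1, h2, h3⟩ := h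
  obtain ⟨γ', h1', h2', h3'⟩ := h'
  have hl : ∀ a b, γ a b * (G b / G b) = γ a b := fun a b => by
    by_cases h0 : G b = 0
    · have : γ a b = 0 := ENNReal.tsum_eq_zero.1 ((h3 b).trans h0) a
      simp [this]
    · rw [ENNReal.div_self h0 (hG b), mul_one]
  have hr : ∀ b c, (G b / G b) * γ' b c = γ' b c := fun b c => by
    by_cases h0 : G b = 0
    · have : γ' b c = 0 := ENNReal.tsum_eq_zero.1 ((h2' b).trans h0) c
      simp [this]
    · rw [ENNReal.div_self h0 (hG b), one_mul]
  refine ⟨fun a c => ∑' b, γ a b * γ' b c / G b, fun a c hac => ?_, fun a => ?_, fun c => ?_⟩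
  · obtain ⟨b, hb⟩ : ∃ b, γ a b * γ' b c / G b ≠ 0 := by
      by_contra! h
      exact hac (ENNReal.tsum_eq_zero.2 h)
    have hm : γ a b * γ' b c ≠ 0 := fun h => hb (by simp [h])
    exact hR a b c (h1 _ _ (left_ne_zero_of_mul hm)) (h1' _ _ (right_ne_zero_of_mul hm))
  · rw [ENNReal.tsum_comm, ← h2 a]
    refine tsum_congr fun b => ?_
    simp only [div_eq_mul_inv]
    rw [ENNReal.tsum_mul_right, ENNReal.tsum_mul_left, h2', mul_assoc, ← div_eq_mul_inv, hl]
  · rw [ENNReal.tsum_comm, ← h3' c]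
    refine tsum_congr fun b => ?_
    simp only [div_eq_mul_inv, mul_assoc]
    rw [ENNReal.tsum_mul_right, h3, mul_comm (γ' b c), ← mul_assoc, ← div_eq_mul_inv, hr]

lemma single [DecidableEq A] {a b : A} (h : R a b) :
    Transports R (Pi.single a 1) (Pi.single b 1) := by
  refine ⟨fun a' b' => if a' = a ∧ b' = b then 1 else 0, fun a' b' hab => ?_, fun a' => ?_,
    fun b' => ?_⟩
  · simp only [ne_eq, ite_eq_right_iff, one_ne_zero, imp_false, not_not] at hab
    rwa [hab.1, hab.2]
  · by_cases ha : a' = a <;> simp [ha]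
  · by_cases hb : b' = b <;> simp [hb]

end Transports

/-! ### Majorization through sums over subsets -/

/-- `x` and `y` have the same sum, and every partial sum of `y` is at most a partial sum of `x`
with the same number of terms. -/
def SetMajorizes {σ : Type*} [Fintype σ] (x y : σ → ℝ) : Prop :=
  ∑ i, x i = ∑ i, y i ∧
    ∀ S : Finset σ, ∃ T : Finset σ, T.card = S.card ∧ ∑ i ∈ S, y i ≤ ∑ i ∈ T, x i

namespace SetMajorizes

variable {σ : Type*} [Fintype σ] {x y z : σ → ℝ}

lemma refl (x : σ → ℝ) : SetMajorizes x x := ⟨rfl, fun S => ⟨S, rfl, le_rfl⟩⟩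

lemma trans (h : SetMajorizes x y) (h' : SetMajorizes y z) : SetMajorizes x z := by
  refine ⟨h.1.trans h'.1, fun S => ?_⟩
  obtain ⟨T, hT, hS⟩ := h'.2 S
  obtain ⟨U, hU, hT'⟩ := h.2 T
  exact ⟨U, hU.trans hT, hS.trans hT'⟩

lemma comp_perm (x : σ → ℝ) (e : Equiv.Perm σ) : SetMajorizes x fun i => x (e i) :=
  ⟨(Equiv.sum_comp e x).symm, fun S => ⟨S.map e.toEmbedding, by simp, by simp⟩⟩

lemma const_mul {r : ℝ} (hr : 0 ≤ r) (h : SetMajorizes x y) :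
    SetMajorizes (fun i => r * x i) fun i => r * y i := by
  refine ⟨by simp only [← Finset.mul_sum, h.1], fun S => ?_⟩
  obtain ⟨T, hT, hS⟩ := h.2 S
  refine ⟨T, hT, ?_⟩
  simp only [← Finset.mul_sum]
  exact mul_le_mul_of_nonneg_left hS hr

/-- Only a set containing `j` but not `i` needs care; exchanging `j` for `i` in it does not lower
the sum. For all other sets `T = S` works. -/
lemma add_single [DecidableEq σ] {i j : σ} (h : x j ≤ x i) :
    SetMajorizes (x + Pi.single i 1) (x + Pi.single j 1) := by
  constructor
  · simp [Finset.sum_add_distrib]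
  intro S
  by_cases hj : j ∈ S
  · by_cases hi : i ∈ S
    · exact ⟨S, rfl, by simp [Finset.sum_add_distrib, Finset.sum_pi_single', hi, hj]⟩
    · have hi' : i ∉ S.erase j := fun h => hi (Finset.mem_of_mem_erase h)
      refine ⟨insert i (S.erase j), ?_, ?_⟩
      · rw [Finset.card_insert_of_notMem hi', Finset.card_erase_add_one hj]
      · rw [← Finset.add_sum_erase _ _ hj, Finset.sum_insert hi']
        simp only [Pi.add_apply, Pi.single_eq_same, Finset.sum_add_distrib, Finset.sum_pi_single']
        simp [hi]
        linarith
  · refine ⟨S, rfl, Finset.sum_le_sum fun k hk => ?_⟩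
    have : k ≠ j := fun h => hj (h ▸ hk)
    simp only [Pi.add_apply, Pi.single_eq_of_ne this, add_zero, le_add_iff_nonneg_right]
    by_cases hki : k = i
    · simp [hki]
    · simp [hki]

end SetMajorizes

/-! ### Sorted vectors and top sets -/

section Sorted

variable {d : ℕ}

lemma sortDown_eq_comp (x : Fin d → ℝ) (i : Fin d) :
    sortDown x i = x ((Fin.revPerm.trans (Tuple.sort x)) i) := rfl

lemma antitone_sortDown (x : Fin d → ℝ) : Antitone (sortDown x) := fun _ _ h =>
  Tuple.monotone_sort x (Fin.rev_le_rev.2 h)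

lemma sum_le_sum_filter_val_lt {l : ℕ} {f : Fin d → ℝ} {S : Finset (Fin d)} (hf : Antitone f)
    (hS : S.card = l) :
    ∑ i ∈ S, f i ≤ ∑ i ∈ Finset.univ.filter (fun i : Fin d => (i : ℕ) < l), f i := by
  have hl : l ≤ d := hS ▸ card_finset_fin_le S
  set I := Finset.univ.filter (fun i : Fin d => (i : ℕ) < l) with hI
  have hIc : I.card = l := by
    rw [hI, Fin.card_filter_val_lt, min_eq_right hl]
  rcases Nat.eq_zero_or_pos l with rfl | hpos
  · rw [Finset.card_eq_zero.1 hS, Finset.card_eq_zero.1 hIc]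
  -- `θ` is the smallest value on the initial segment, so `f - θ` is nonnegative there and
  -- nonpositive elsewhere. Equal cardinalities let `θ` cancel at the end.
  set θ := f ⟨l - 1, by omega⟩ with hθ
  have key : ∑ i ∈ S, (f i - θ) ≤ ∑ i ∈ I, (f i - θ) := by
    rw [← Finset.sum_inter_add_sum_sdiff S I]
    have h1 : ∑ i ∈ S \ I, (f i - θ) ≤ 0 := Finset.sum_nonpos fun i hi => by
      simp only [hI, Finset.mem_sdiff, Finset.mem_filter, Finset.mem_univ, true_and, not_lt] at hi
      exact sub_nonpos.2 (hf (Fin.le_def.2 (by simp; omega)))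
    have h2 : ∑ i ∈ S ∩ I, (f i - θ) ≤ ∑ i ∈ I, (f i - θ) :=
      Finset.sum_le_sum_of_subset_of_nonneg Finset.inter_subset_right fun i hi _ => by
        simp only [hI, Finset.mem_filter, Finset.mem_univ, true_and] at hi
        exact sub_nonneg.2 (hf (Fin.le_def.2 (by simp; omega)))
    linarith
  simp only [Finset.sum_sub_distrib, Finset.sum_const, hS, hIc] at key
  linarith

lemma exists_top_finset (x : Fin d → ℝ) (S : Finset (Fin d)) :
    ∃ T : Finset (Fin d), T.card = S.card ∧ ∑ i ∈ S, x i ≤ ∑ i ∈ T, x i ∧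
      ∀ i ∈ T, ∀ j ∉ T, x j ≤ x i := by
  set e : Equiv.Perm (Fin d) := Fin.revPerm.trans (Tuple.sort x) with he
  have hl : S.card ≤ d := card_finset_fin_le S
  refine ⟨(Finset.univ.filter fun i : Fin d => (i : ℕ) < S.card).map e.toEmbedding, ?_, ?_, ?_⟩
  · rw [Finset.card_map, Fin.card_filter_val_lt, min_eq_right hl]
  · have h := sum_le_sum_filter_val_lt (S := S.map e.symm.toEmbedding) (antitone_sortDown x)
      (Finset.card_map _)
    simpa [sortDown_eq_comp, ← he] using h
  · intro i hi j hj
    obtain ⟨i, rfl⟩ := e.surjective i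
    obtain ⟨j, rfl⟩ := e.surjective j
    simp only [Finset.mem_map_equiv, Equiv.symm_apply_apply, Finset.mem_filter, Finset.mem_univ,
      true_and, not_lt] at hi hj
    exact antitone_sortDown x (Fin.le_def.2 (by omega))

/-- The sum of the `l` largest components is the maximum over sets of size `l`. The set form is
transitive and permutation invariant without any sorting. -/
theorem majorizes_iff_setMajorizes {x y : Fin d → ℝ} : Majorizes x y ↔ SetMajorizes x y := by
  have hmap : ∀ (z : Fin d → ℝ) (l : ℕ),
      ∑ i ∈ Finset.univ.filter (fun i : Fin d => (i : ℕ) < l), sortDown z i =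
      ∑ i ∈ (Finset.univ.filter (fun i : Fin d => (i : ℕ) < l)).map
        (Fin.revPerm.trans (Tuple.sort z)).toEmbedding, z i := fun z l => by
    simp [sortDown_eq_comp]
  have hmap' : ∀ (z : Fin d → ℝ) (S : Finset (Fin d)), ∑ i ∈ S, z i ≤
      ∑ i ∈ Finset.univ.filter (fun i : Fin d => (i : ℕ) < S.card), sortDown z i := fun z S => by
    have h := sum_le_sum_filter_val_lt
      (S := S.map (Fin.revPerm.trans (Tuple.sort z)).symm.toEmbedding)
      (antitone_sortDown z) (Finset.card_map _)
    simpa [sortDown_eq_comp] using h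
  constructor
  · rintro ⟨h, hs⟩
    refine ⟨hs, fun S => ?_⟩
    rcases Nat.eq_zero_or_pos S.card with h0 | hpos
    · exact ⟨∅, by simp [h0], by simp [Finset.card_eq_zero.1 h0]⟩
    have hl : S.card ≤ d := card_finset_fin_le S
    refine ⟨(Finset.univ.filter (fun i : Fin d => (i : ℕ) < S.card)).map
        (Fin.revPerm.trans (Tuple.sort x)).toEmbedding, ?_, ?_⟩
    · rw [Finset.card_map, Fin.card_filter_val_lt, min_eq_right hl]
    · rw [← hmap]
      exact (hmap' y S).trans (h _ hpos hl)
  · rintro ⟨hs, h⟩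
    refine ⟨fun l _ hl => ?_, hs⟩
    obtain ⟨T, hT, hle⟩ := h ((Finset.univ.filter (fun i : Fin d => (i : ℕ) < l)).map
        (Fin.revPerm.trans (Tuple.sort y)).toEmbedding)
    rw [Finset.card_map, Fin.card_filter_val_lt, min_eq_right hl] at hT
    rw [hmap y l]
    exact hle.trans (hT ▸ hmap' x T)

/-- A vector that puts additional weight on its large components majorizes the original one. -/
lemma setMajorizes_mul_add_sub {x : Fin d → ℝ} (hx : ∀ i, 0 ≤ x i) (hs : ∑ i, x i = 1) :
    SetMajorizes (fun i => x i * (1 + x i - ∑ j, x j ^ 2)) x := by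
  set s := ∑ j, x j ^ 2 with hsq
  have hexp : ∀ T : Finset (Fin d), ∑ i ∈ T, x i * (1 + x i - s) =
      ∑ i ∈ T, x i + ∑ i ∈ T, x i * (x i - s) := fun T => by
    rw [← Finset.sum_add_distrib]
    exact Finset.sum_congr rfl fun i _ => by ring
  have hzero : ∑ i, x i * (x i - s) = 0 := by
    simp only [mul_sub, Finset.sum_sub_distrib, ← Finset.sum_mul, hs, hsq, sq]
    ring
  refine ⟨by rw [hexp, hzero, add_zero], fun S => ?_⟩
  obtain ⟨T, hT, hle, htop⟩ := exists_top_finset x S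
  refine ⟨T, hT, ?_⟩
  rw [hexp]
  suffices 0 ≤ ∑ i ∈ T, x i * (x i - s) by linarith
  -- Either every term over the top set `T` is nonnegative, or some element of `T` is below `s`. In
  -- the latter case everything outside `T` is below `s` too, so the complement contributes at most
  -- zero to a total of zero.
  by_cases hall : ∀ i ∈ T, s ≤ x i
  · exact Finset.sum_nonneg fun i hi => mul_nonneg (hx i) (sub_nonneg.2 (hall i hi))
  · push Not at hall
    obtain ⟨i, hi, his⟩ := hall
    rw [← Finset.sum_add_sum_compl T] at hzero
    have : ∑ j ∈ Tᶜ, x j * (x j - s) ≤ 0 := Finset.sum_nonpos fun j hj =>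
      mul_nonpos_of_nonneg_of_nonpos (hx j)
        (sub_nonpos.2 ((htop i hi j (Finset.mem_compl.1 hj)).trans his.le))
    linarith

end Sorted

/-- The support of `c'` carries all `n` nodes, so some set `T` of the same size carries all nodes of
`c`, and the support of `c` lies inside `T`. -/
lemma Config.numColors_le_of_setMajorizes {n : ℕ} {c c' : Config n}
    (h : SetMajorizes (fun i => (c i : ℝ)) (fun i => (c' i : ℝ))) :
    c.numColors ≤ c'.numColors := by
  obtain ⟨T, hT, hle⟩ := h.2 (Finset.univ.filter fun i => 0 < c' i)
  have h' : ∑ i ∈ Finset.univ.filter (fun i => 0 < c' i), c' i = ∑ i, c' i :=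
    Finset.sum_subset (Finset.subset_univ _) fun i _ hi => by
      simpa using hi
  have hTn : n ≤ ∑ i ∈ T, c i := by
    have : ((∑ i ∈ Finset.univ.filter (fun i => 0 < c' i), c' i : ℕ) : ℝ) ≤
      ((∑ i ∈ T, c i : ℕ) : ℝ) := by push_cast; exact hle
    rw [h', c'.2] at this
    exact_mod_cast this
  unfold Config.numColors
  rw [← hT]
  refine Finset.card_le_card fun i hi => ?_
  by_contra hiT
  have hlt : ∑ i ∈ T, c i < ∑ i, c i :=
    Finset.sum_lt_sum_of_subset (Finset.subset_univ T) (Finset.mem_univ i) hiT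
      (Finset.mem_filter.1 hi).2 fun _ _ _ => Nat.zero_le _
  rw [c.2] at hlt
  omega

/-! ### Polynomials as weights on count vectors -/

section Polynomials

open MvPolynomial
open scoped NNReal

variable {σ : Type*}

section Tilted

variable [DecidableEq σ]

/-- Exchanging the exponents of `i` and `j` in favour of `j` does not increase coefficients. -/
def Tilted (i j : σ) (F : MvPolynomial σ ℝ≥0) : Prop :=
  ∀ b : σ →₀ ℕ, b j ≤ b i → F.coeff (b.mapDomain (Equiv.swap i j)) ≤ F.coeff b

lemma mapDomain_swap_apply (i j : σ) (b : σ →₀ ℕ) (a : σ) :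
    b.mapDomain (Equiv.swap i j) a = b (Equiv.swap i j a) := by
  conv_lhs => rw [← Equiv.swap_apply_self i j a]
  exact Finsupp.mapDomain_apply (Equiv.injective _) _ _

lemma mapDomain_swap_swap (i j : σ) (b : σ →₀ ℕ) :
    (b.mapDomain (Equiv.swap i j)).mapDomain (Equiv.swap i j) = b := by
  ext a
  simp only [mapDomain_swap_apply, Equiv.swap_apply_self]

lemma coeff_rename_swap (i j : σ) (F : MvPolynomial σ ℝ≥0) (b : σ →₀ ℕ) :
    (rename (Equiv.swap i j) F).coeff b = F.coeff (b.mapDomain (Equiv.swap i j)) := by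
  conv_lhs => rw [← mapDomain_swap_swap i j b]
  exact coeff_rename_mapDomain _ (Equiv.injective _) _ _

lemma mapDomain_swap_of_eq {i j : σ} {b : σ →₀ ℕ} (h : b i = b j) :
    b.mapDomain (Equiv.swap i j) = b := by
  ext a
  rw [mapDomain_swap_apply, Equiv.swap_apply_def]
  split_ifs with h1 h2
  · rw [h1, h]
  · rw [h2, h]
  · rfl

namespace Tilted

variable {i j : σ} {F G : MvPolynomial σ ℝ≥0}

lemma of_rename_eq (h : rename (Equiv.swap i j) F = F) : Tilted i j F := fun b _ => by
  rw [← coeff_rename_swap, h]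

/-- If the swapped exponent also occurs in `F`, then `b i = b j` and the swap fixes `b`; otherwise
its coefficient is zero. -/
lemma of_support (h : ∀ b ∈ F.support, b j ≤ b i) : Tilted i j F := fun b hb => by
  by_cases h0 : F.coeff (b.mapDomain (Equiv.swap i j)) = 0
  · rw [h0]; exact zero_le
  · have := h _ (mem_support_iff.2 h0)
    simp only [mapDomain_swap_apply, Equiv.swap_apply_left, Equiv.swap_apply_right] at this
    rw [mapDomain_swap_of_eq (le_antisymm this hb)]

lemma add (hF : Tilted i j F) (hG : Tilted i j G) : Tilted i j (F + G) := fun b hb => by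
  simpa using add_le_add (hF b hb) (hG b hb)

/-- A tilted polynomial is the sum of a symmetric one and of one in which every exponent of `i`
exceeds that of `j`. -/
lemma exists_decomposition (hF : Tilted i j F) : ∃ M E : MvPolynomial σ ℝ≥0, F = M + E ∧
    rename (Equiv.swap i j) M = M ∧ ∀ b ∈ E.support, b j < b i := by
  set s : (σ →₀ ℕ) → (σ →₀ ℕ) := fun b => b.mapDomain (Equiv.swap i j) with hs
  have hss : ∀ b, s (s b) = b := mapDomain_swap_swap i j
  -- `M` keeps the part of each coefficient shared with the swapped exponent, and `E` is the excess,
  -- by truncated subtraction. Tiltedness makes the excess vanish unless `b j < b i`.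
  let M : MvPolynomial σ ℝ≥0 :=
    ∑ b ∈ F.support, monomial b (min (F.coeff b) (F.coeff (s b)))
  let E : MvPolynomial σ ℝ≥0 :=
    ∑ b ∈ F.support, monomial b (F.coeff b - F.coeff (s b))
  have hsum : ∀ (g : (σ →₀ ℕ) → ℝ≥0) (b : σ →₀ ℕ), (F.coeff b = 0 → g b = 0) →
      (∑ b ∈ F.support, MvPolynomial.monomial b (g b)).coeff b = g b := fun g b hg => by
    rw [coeff_sum]
    simp only [coeff_monomial, Finset.sum_ite_eq']
    split_ifs with h
    · rfl
    · exact (hg (notMem_support_iff.1 h)).symm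
  have hM : ∀ b, M.coeff b = min (F.coeff b) (F.coeff (s b)) := fun b =>
    hsum _ b fun h => by simp [h]
  have hE : ∀ b, E.coeff b = F.coeff b - F.coeff (s b) := fun b =>
    hsum _ b fun h => by simp [h]
  refine ⟨M, E, ?_, ?_, fun b hb => ?_⟩
  · ext1 b
    rw [coeff_add, hM, hE, add_comm]
    exact tsub_add_min.symm
  · ext1 b
    rw [coeff_rename_swap, hM, hM, min_comm]
    change min (F.coeff (s (s b))) _ = _
    rw [hss]
  · by_contra! h
    refine mem_support_iff.1 hb ((hE b).trans (tsub_eq_zero_of_le ?_))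
    have := hF (s b) (by simpa [hs, mapDomain_swap_apply] using h)
    exact (congrArg F.coeff (hss b)).ge.trans this

end Tilted

end Tilted

/-- The coefficients of `F`, as a weight on exponents. -/
noncomputable def coeffWeight (F : MvPolynomial σ ℝ≥0) (b : σ →₀ ℕ) : ℝ≥0∞ :=
  ((F.coeff b : ℝ≥0) : ℝ≥0∞)

lemma coeffWeight_add (F G : MvPolynomial σ ℝ≥0) :
    coeffWeight (F + G) = coeffWeight F + coeffWeight G := by
  ext b; simp [coeffWeight]

lemma coeffWeight_C_mul (r : ℝ≥0) (F : MvPolynomial σ ℝ≥0) :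
    coeffWeight (C r * F) = (r : ℝ≥0∞) • coeffWeight F := by
  ext b; simp [coeffWeight, coeff_C_mul]

/-! ### Domination of polynomials and linear forms -/

variable [Fintype σ]

/-- The coefficients of `F` can be transported to those of `G` along majorization of exponents. -/
def Dominates (F G : MvPolynomial σ ℝ≥0) : Prop :=
  Transports (fun b b' : σ →₀ ℕ => SetMajorizes (fun i => (b i : ℝ)) (fun i => (b' i : ℝ)))
    (coeffWeight F) (coeffWeight G)

namespace Dominates

variable {F G H F' G' : MvPolynomial σ ℝ≥0}

lemma add (h : Dominates F G) (h' : Dominates F' G') : Dominates (F + F') (G + G') := by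
  unfold Dominates
  rw [coeffWeight_add, coeffWeight_add]
  exact Transports.add h h'

lemma C_mul (r : ℝ≥0) (h : Dominates F G) : Dominates (C r * F) (C r * G) := by
  unfold Dominates
  rw [coeffWeight_C_mul, coeffWeight_C_mul]
  exact Transports.smul _ h

lemma trans (h : Dominates F G) (h' : Dominates G H) : Dominates F H :=
  Transports.trans (R := fun b b' : σ →₀ ℕ => SetMajorizes (fun i => (b i : ℝ)) fun i => (b' i : ℝ))
    (fun _ _ _ => SetMajorizes.trans) (fun _ => ENNReal.coe_ne_top) h h'

lemma rename_perm (e : Equiv.Perm σ) (F : MvPolynomial σ ℝ≥0) : Dominates F (rename e F) := by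
  have h := Transports.of_equiv (F := coeffWeight F)
    (R := fun b b' : σ →₀ ℕ => SetMajorizes (fun i => (b i : ℝ)) (fun i => (b' i : ℝ)))
    (Finsupp.domCongr e).toEquiv
    (fun b => SetMajorizes.comp_perm (fun i => (b i : ℝ)) e.symm)
  unfold Dominates
  convert h using 1
  ext b
  obtain ⟨b, rfl⟩ := (Finsupp.domCongr e).surjective b
  change (((rename e F).coeff _ : ℝ≥0) : ℝ≥0∞) =
    ((F.coeff ((Finsupp.domCongr e).symm _) : ℝ≥0) : ℝ≥0∞)
  rw [AddEquiv.symm_apply_apply, Finsupp.domCongr_apply, Finsupp.equivMapDomain_eq_mapDomain,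
    coeff_rename_mapDomain _ e.injective]

lemma refl (F : MvPolynomial σ ℝ≥0) : Dominates F F := by
  simpa using rename_perm (Equiv.refl σ) F

lemma monomial {b b' : σ →₀ ℕ}
    (h : SetMajorizes (fun i => (b i : ℝ)) (fun i => (b' i : ℝ))) (r : ℝ≥0) :
    Dominates (monomial b r) (monomial b' r) := by
  classical
  have hs : ∀ c : σ →₀ ℕ, coeffWeight (MvPolynomial.monomial c (1 : ℝ≥0)) = Pi.single c 1 := by
    intro c
    ext a
    by_cases hac : a = c
    · simp [hac, coeffWeight]
    · simp [hac, coeffWeight, coeff_monomial, Ne.symm hac]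
  have h1 : Dominates (MvPolynomial.monomial b 1) (MvPolynomial.monomial b' 1) := by
    unfold Dominates
    rw [hs, hs]
    exact Transports.single h
  simpa [C_mul_monomial] using h1.C_mul r

lemma sum {ι : Type*} (s : Finset ι) {F G : ι → MvPolynomial σ ℝ≥0}
    (h : ∀ i ∈ s, Dominates (F i) (G i)) : Dominates (∑ i ∈ s, F i) (∑ i ∈ s, G i) := by
  classical
  induction s using Finset.induction_on with
  | empty => simpa using refl 0
  | insert i s hi ih =>
    rw [Finset.sum_insert hi, Finset.sum_insert hi]
    exact (h i (Finset.mem_insert_self i s)).add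
      (ih fun j hj => h j (Finset.mem_insert_of_mem hj))

end Dominates

/-- The linear form with coefficients `x`. Its `n`-th power is the generating polynomial of the
multinomial law with parameters `n` and `x`. -/
noncomputable def linearForm (x : σ → ℝ≥0) : MvPolynomial σ ℝ≥0 := ∑ a, C (x a) * X a

lemma linearForm_add (x y : σ → ℝ≥0) : linearForm (x + y) = linearForm x + linearForm y := by
  simp [linearForm, add_mul, Finset.sum_add_distrib]

lemma linearForm_smul (r : ℝ≥0) (x : σ → ℝ≥0) : linearForm (r • x) = C r * linearForm x := by
  simp [linearForm, Finset.mul_sum, mul_assoc]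

lemma rename_linearForm (e : Equiv.Perm σ) (x : σ → ℝ≥0) :
    rename e (linearForm x) = linearForm fun a => x (e.symm a) := by
  simp only [linearForm, map_sum, map_mul, rename_C, rename_X]
  rw [← Equiv.sum_comp e fun a => C (x (e.symm a)) * X a]
  simp

variable [DecidableEq σ]

/-- The average of `x` and of `x` with the components `i` and `j` exchanged. -/
noncomputable def averageSwap (i j : σ) (x : σ → ℝ≥0) : σ → ℝ≥0 :=
  fun a => (x a + x (Equiv.swap i j a)) / 2

lemma linearForm_single (i : σ) (r : ℝ≥0) :
    linearForm (Pi.single i r) = C r * X i := by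
  rw [linearForm, Finset.sum_eq_single i]
  · simp
  · intro a _ ha; simp [ha]
  · simp

/-- The symmetric part stays symmetric, since the linear form is invariant under the swap. In the
other part the strict gap `b j < b i` shrinks by at most one, leaving `b j ≤ b i`. -/
lemma Tilted.mul_linearForm_of_eq {i j : σ} {F : MvPolynomial σ ℝ≥0}
    {u : σ → ℝ≥0} (hF : Tilted i j F) (hu : u i = u j) :
    Tilted i j (F * linearForm u) := by
  obtain ⟨M, E, rfl, hM, hE⟩ := hF.exists_decomposition
  rw [add_mul]
  refine Tilted.add (Tilted.of_rename_eq ?_) (Tilted.of_support fun b hb => ?_)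
  · rw [map_mul, hM, rename_linearForm]
    congr 2
    ext a
    rw [Equiv.symm_swap, Equiv.swap_apply_def]
    split_ifs with h1 h2
    · rw [h1, hu]
    · rw [h2, hu]
    · rfl
  · rw [linearForm, Finset.mul_sum] at hb
    obtain ⟨a, -, ha⟩ := Finset.mem_biUnion.1 (support_sum hb)
    rw [mul_left_comm, mem_support_iff, coeff_C_mul, coeff_mul_X'] at ha
    have ha' := right_ne_zero_of_mul ha
    split_ifs at ha' with h
    · have h1 := hE _ (mem_support_iff.2 ha')
      simp only [Finsupp.tsub_apply, Finsupp.single_apply] at h1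
      have : 0 < b a := Nat.pos_of_ne_zero (Finsupp.mem_support_iff.1 h)
      split_ifs at h1 <;> omega
    · exact absurd rfl ha'

end Polynomials

/-! ### Majorized parameters give dominated multinomial laws -/

section Powers

open MvPolynomial
open scoped NNReal

variable {σ : Type*} [Fintype σ] [DecidableEq σ]

/-- Isolates the dependence on `x`: the remaining factor is the multinomial coefficient, which is
symmetric in the variables. -/
lemma coeff_linearForm_pow (x : σ → ℝ≥0) (k : ℕ) (b : σ →₀ ℕ) :
    (linearForm x ^ k).coeff b = (∏ a, x a ^ b a) * (linearForm (1 : σ → ℝ≥0) ^ k).coeff b := by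
  induction k generalizing b with
  | zero =>
    simp only [pow_zero, coeff_one]
    split_ifs with h
    · simp [← h]
    · simp
  | succ k ih =>
    have hstep : ∀ y : σ → ℝ≥0, (linearForm y ^ (k + 1)).coeff b =
        ∑ a, y a * if a ∈ b.support then (linearForm y ^ k).coeff (b - Finsupp.single a 1)
          else 0 := fun y => by
      rw [pow_succ]
      conv_lhs => enter [2, 2]; rw [linearForm]
      rw [Finset.mul_sum, coeff_sum]
      refine Finset.sum_congr rfl fun a _ => ?_
      rw [mul_left_comm, coeff_C_mul, coeff_mul_X']
    rw [hstep, hstep, Finset.mul_sum]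
    refine Finset.sum_congr rfl fun a _ => ?_
    split_ifs with h
    · rw [ih]
      have hb : b a - 1 + 1 = b a := Nat.succ_pred (Finsupp.mem_support_iff.1 h)
      have : ∏ c, x c ^ b c = x a * ∏ c, x c ^ (b - Finsupp.single a 1 : σ →₀ ℕ) c := by
        rw [← Finset.mul_prod_erase _ _ (Finset.mem_univ a),
          ← Finset.mul_prod_erase _ (fun c => x c ^ (b - Finsupp.single a 1 : σ →₀ ℕ) c)
            (Finset.mem_univ a), ← mul_assoc]
        congr 1
        · simp only [Finsupp.tsub_apply, Finsupp.single_eq_same]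
          rw [← pow_succ', hb]
        · refine Finset.prod_congr rfl fun c hc => ?_
          simp [Finsupp.single_eq_of_ne (Finset.ne_of_mem_erase hc)]
      rw [this, Pi.one_apply, one_mul, mul_assoc]
    · simp

lemma tilted_linearForm_pow {i j : σ} {x : σ → ℝ≥0} (hx : x j ≤ x i) (k : ℕ) :
    Tilted i j (linearForm x ^ k) := by
  intro b hb
  by_cases hij : i = j
  · subst hij; simp
  rw [coeff_linearForm_pow, coeff_linearForm_pow x k b, ← coeff_rename_swap, map_pow,
    rename_linearForm]
  refine mul_le_mul_left ?_ _
  have hj : j ∈ Finset.univ.erase i := Finset.mem_erase.2 ⟨Ne.symm hij, Finset.mem_univ j⟩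
  have hsplit : ∀ f : σ → ℝ≥0, ∏ a, f a = f i * f j * ∏ a ∈ (Finset.univ.erase i).erase j, f a :=
    fun f => by
      rw [← Finset.mul_prod_erase _ _ (Finset.mem_univ i), ← Finset.mul_prod_erase _ _ hj,
        mul_assoc]
  rw [hsplit, hsplit fun a => x a ^ b a]
  simp only [mapDomain_swap_apply, Equiv.swap_apply_left, Equiv.swap_apply_right]
  have hrest : ∏ a ∈ (Finset.univ.erase i).erase j, x a ^ b (Equiv.swap i j a) =
      ∏ a ∈ (Finset.univ.erase i).erase j, x a ^ b a := Finset.prod_congr rfl fun a ha => by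
    rw [Equiv.swap_apply_of_ne_of_ne (Finset.ne_of_mem_erase (Finset.mem_of_mem_erase ha))
      (Finset.ne_of_mem_erase ha)]
  rw [hrest]
  refine mul_le_mul_left ?_ _
  obtain ⟨m, hm⟩ := Nat.exists_eq_add_of_le hb
  rw [hm, pow_add, pow_add]
  calc x i ^ b j * (x j ^ b j * x j ^ m) ≤ x i ^ b j * (x j ^ b j * x i ^ m) := by gcongr
    _ = _ := by ring

lemma dominates_linearForm_averageSwap {i j : σ} {F : MvPolynomial σ ℝ≥0} {x : σ → ℝ≥0}
    (hF : Tilted i j F) (hx : x j ≤ x i) (hij : i ≠ j) :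
    Dominates (F * linearForm x) (F * linearForm (averageSwap i j x)) := by
  obtain ⟨M, E, rfl, hM, hE⟩ := hF.exists_decomposition
  rw [add_mul, add_mul]
  refine Dominates.add ?_ ?_
  · have hu : linearForm (averageSwap i j x) = C (1 / 2) * linearForm x +
        C (1 / 2) * linearForm (fun a => x ((Equiv.swap i j).symm a)) := by
      rw [← linearForm_smul, ← linearForm_smul, ← linearForm_add]
      congr 1
      ext a
      simp [averageSwap, div_eq_inv_mul, mul_add]
    have h2 : (C (1 / 2) + C (1 / 2) : MvPolynomial σ ℝ≥0) = 1 := by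
      rw [← C_add, add_halves, C_1]
    have h1 := Dominates.rename_perm (Equiv.swap i j) (M * linearForm x)
    rw [map_mul, hM, rename_linearForm] at h1
    have h3 := ((Dominates.refl (M * linearForm x)).C_mul (1 / 2)).add (h1.C_mul (1 / 2))
    rw [← add_mul, h2, one_mul] at h3
    rw [hu]
    convert h3 using 1
    ring
  -- With `δ` half the gap, `x` and its average share a common part `w` and differ by `δ` placed at
  -- `i` or at `j`. Exponents of `E` favour `i`, so moving one unit to `j` goes down in
  -- majorization.
  · obtain ⟨δ, hδ⟩ : ∃ δ, x i = x j + 2 * δ := by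
      obtain ⟨m, hm⟩ := exists_add_of_le hx
      exact ⟨m / 2, by rw [hm, mul_div_cancel₀ _ two_ne_zero]⟩
    let w := Function.update (averageSwap i j x) j (x j)
    have hi : averageSwap i j x i = x j + δ := by
      rw [averageSwap, Equiv.swap_apply_left, hδ]
      field_simp
      ring
    have hj : averageSwap i j x j = x j + δ := by
      rw [averageSwap, Equiv.swap_apply_right, hδ]
      field_simp
      ring
    have ha : ∀ a, a ≠ i → a ≠ j → averageSwap i j x a = x a := fun a hai haj => by
      rw [averageSwap, Equiv.swap_apply_of_ne_of_ne hai haj, add_self_div_two]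
    have hxw : x = w + Pi.single i δ := by
      ext1 a
      by_cases hai : a = i
      · subst hai
        simp only [w, Pi.add_apply, Function.update_of_ne hij, Pi.single_eq_same]
        rw [hi, hδ]; ring
      · by_cases haj : a = j
        · subst haj
          simp [w, hai]
        · simp [w, hai, haj, ha]
    have huw : averageSwap i j x = w + Pi.single j δ := by
      ext1 a
      by_cases haj : a = j
      · subst haj
        simp [w, hj]
      · simp [w, haj]
    rw [huw]
    conv_lhs => rw [hxw]
    rw [linearForm_add, linearForm_add, mul_add, mul_add, linearForm_single, linearForm_single]
    refine (Dominates.refl _).add ?_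
    rw [mul_left_comm, mul_left_comm E]
    refine Dominates.C_mul δ ?_
    rw [E.as_sum, Finset.sum_mul, Finset.sum_mul]
    refine Dominates.sum _ fun b hb => ?_
    rw [X, X, monomial_mul, monomial_mul]
    refine Dominates.monomial ?_ _
    have h := SetMajorizes.add_single (x := fun a => (b a : ℝ)) (i := i) (j := j)
      (Nat.cast_le.2 (hE b hb).le)
    have hcast : ∀ a, (fun c => (((b + Finsupp.single a 1 : σ →₀ ℕ) c : ℕ) : ℝ)) =
        (fun c => (b c : ℝ)) + Pi.single a 1 := fun a => by
      ext c
      by_cases hc : c = a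
      · subst hc; simp
      · simp [hc]
    rwa [hcast, hcast]

/-- Expand one factor `linearForm y` as the convex combination. The `x` branch is the induction
hypothesis; the `u` branch first turns one factor `x` into `u`. General `m` and `l` absorb the
factors so produced. -/
lemma dominates_pow_of_averageSwap {i j : σ} {x y : σ → ℝ≥0} {r t : ℝ≥0} (hij : i ≠ j)
    (hx : x j ≤ x i) (hrt : r + t = 1)
    (hy : linearForm y = C r * linearForm x + C t * linearForm (averageSwap i j x)) (k m l : ℕ) :
    Dominates (linearForm x ^ (m + k) * linearForm (averageSwap i j x) ^ l)
      (linearForm x ^ m * linearForm y ^ k * linearForm (averageSwap i j x) ^ l) := by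
  induction k generalizing m l with
  | zero => simpa using Dominates.refl _
  | succ k ih =>
    set u := averageSwap i j x with hu
    have huij : u i = u j := by
      simp [hu, averageSwap, add_comm]
    have htilt : ∀ p q, Tilted i j (linearForm x ^ p * linearForm u ^ q) := fun p q => by
      induction q with
      | zero => simpa using tilted_linearForm_pow hx p
      | succ q ihq =>
        rw [pow_succ, ← mul_assoc]
        exact ihq.mul_linearForm_of_eq huij
    have h1 := ih (m + 1) l
    have h2 := ih m (l + 1)
    have h3 := dominates_linearForm_averageSwap (htilt (m + k) l) hx hij
    have hp : linearForm x ^ (m + k) * linearForm u ^ l * linearForm x =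
        linearForm x ^ (m + (k + 1)) * linearForm u ^ l := by ring
    have hp' : linearForm x ^ (m + k) * linearForm u ^ l * linearForm u =
        linearForm x ^ (m + k) * linearForm u ^ (l + 1) := by ring
    rw [← hu, hp, hp'] at h3
    have h4 := (h1.C_mul r).add ((h3.trans h2).C_mul t)
    rw [show m + 1 + k = m + (k + 1) by ring, ← add_mul, ← C_add, hrt, C_1, one_mul] at h4
    rw [pow_succ (linearForm y), hy, ← hy]
    convert h4 using 1
    nth_rewrite 2 [hy]
    ring

/-- Moving weight from a larger component to a smaller one, without changing their order, gives a
dominated multinomial law. -/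
lemma dominates_pow_of_transfer {i j : σ} {x y : σ → ℝ≥0} {δ : ℝ≥0} (hij : i ≠ j)
    (hi : x i = y i + δ) (hj : y j = x j + δ) (hyij : y j ≤ y i)
    (h : ∀ a, a ≠ i → a ≠ j → x a = y a) (n : ℕ) :
    Dominates (linearForm x ^ n) (linearForm y ^ n) := by
  rcases eq_or_ne δ 0 with rfl | hδ
  · have : x = y := by
      ext1 a
      by_cases hai : a = i
      · rw [hai, hi, add_zero]
      · by_cases haj : a = j
        · rw [haj, hj, add_zero]
        · exact h a hai haj
    rw [this]
    exact Dominates.refl _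
  -- The gap between `i` and `j` is `2 * δ + s` in `x`, `s` in `y` and zero in the average, which
  -- dictates the weights `s / (2 * δ + s)` and `2 * δ / (2 * δ + s)`.
  obtain ⟨s, hs⟩ := exists_add_of_le hyij
  rw [hj] at hs
  rw [hs] at hi
  have hD : 2 * δ + s ≠ 0 := by positivity
  have hrt : s / (2 * δ + s) + 2 * δ / (2 * δ + s) = 1 := by
    rw [← add_div, add_comm, div_self hD]
  have hx : x j ≤ x i := by
    rw [hi, add_assoc, add_assoc]
    exact le_self_add
  have hy : linearForm y = C (s / (2 * δ + s)) * linearForm x +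
      C (2 * δ / (2 * δ + s)) * linearForm (averageSwap i j x) := by
    rw [← linearForm_smul, ← linearForm_smul, ← linearForm_add]
    congr 1
    ext1 a
    simp only [Pi.add_apply, Pi.smul_apply, smul_eq_mul, averageSwap]
    by_cases hai : a = i
    · subst hai
      rw [Equiv.swap_apply_left, hi, hs]
      field_simp
      ring
    · by_cases haj : a = j
      · subst haj
        rw [Equiv.swap_apply_right, hi, hj]
        field_simp
        ring
      · rw [Equiv.swap_apply_of_ne_of_ne hai haj, add_self_div_two, ← add_mul, hrt, one_mul,
          h a hai haj]
  simpa using dominates_pow_of_averageSwap hij hx hrt hy n 0 0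

end Powers

/-! ### From single transfers to majorization -/

section Chain

open MvPolynomial
open scoped NNReal

variable {d : ℕ}

/-- Induction on the number of components where `x` and `y` differ, each transfer settling at least
one. Only `y` has to be sorted, so `x` need not be re-sorted between transfers. -/
lemma dominates_pow_of_prefix_sums {x y : Fin d → ℝ≥0} (hy : Antitone y)
    (hs : ∑ i, x i = ∑ i, y i)
    (hp : ∀ l : ℕ, ∑ i ∈ Finset.univ.filter (fun i : Fin d => (i : ℕ) < l), y i ≤
      ∑ i ∈ Finset.univ.filter (fun i : Fin d => (i : ℕ) < l), x i) (n : ℕ) :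
    Dominates (linearForm x ^ n) (linearForm y ^ n) := by
  induction hN : (Finset.univ.filter fun i => x i ≠ y i).card using Nat.strong_induction_on
    generalizing x with
  | _ N ih =>
  by_cases hxy : x = y
  · rw [hxy]; exact Dominates.refl _
  have hex : ∃ k, x k < y k := by
    by_contra! h
    refine hxy (funext fun i => ?_)
    exact (((Finset.sum_eq_sum_iff_of_le fun i _ => h i).1 hs.symm) i (Finset.mem_univ i)).symm
  obtain ⟨k, hk, hmin⟩ := (wellFounded_lt (α := Fin d)).has_min {k | x k < y k} hex
  have hk : x k < y k := hk
  have hmin : ∀ a < k, y a ≤ x a := fun a ha => not_lt.1 fun h => hmin a h ha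
  -- The first deficit is at `k`; without a surplus before it, the prefix sum up to and including
  -- `k` would be too small.
  obtain ⟨i, hik, hi⟩ : ∃ i < k, y i < x i := by
    by_contra! h
    refine (hp (k + 1)).not_gt (Finset.sum_lt_sum (fun a ha => ?_) ⟨k, by simp, hk⟩)
    have hak : (a : ℕ) < k + 1 := (Finset.mem_filter.1 ha).2
    rcases eq_or_ne a k with rfl | hne
    · exact hk.le
    · exact h a (Fin.lt_def.2 (lt_of_le_of_ne (Nat.lt_succ_iff.1 hak) (Fin.val_ne_of_ne hne)))
  -- The largest transfer that overshoots neither target: `x'` meets `y` at `i` or at `k`, and `x' k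
  -- ≤ y k ≤ y i ≤ x' i` keeps the order.
  set δ := min (x i - y i) (y k - x k) with hδ
  have hδi : δ ≤ x i - y i := min_le_left _ _
  have hδk : δ ≤ y k - x k := min_le_right _ _
  set x' := Function.update (Function.update x i (x i - δ)) k (x k + δ) with hx'
  have hik' : i ≠ k := hik.ne
  have hx'i : x' i = x i - δ := by simp [hx', hik']
  have hx'k : x' k = x k + δ := by simp [hx']
  have hx'a : ∀ a, a ≠ i → a ≠ k → x a = x' a := fun a h1 h2 => by simp [hx', h1, h2]
  have hδx : δ ≤ x i := hδi.trans tsub_le_self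
  have hxi : x i = x' i + δ := by rw [hx'i, tsub_add_cancel_of_le hδx]
  have hyi : y i ≤ x' i := by
    rw [hx'i]
    exact le_tsub_of_add_le_left ((add_le_add_left hδi _).trans (tsub_add_cancel_of_le hi.le).le)
  have hyk : x' k ≤ y k := by
    rw [hx'k]
    exact (add_le_add_right hδk _).trans (add_tsub_cancel_of_le hk.le).le
  have hadd : x' + Pi.single i δ = x + Pi.single k δ := by
    ext1 a
    by_cases hai : a = i
    · subst hai; simp [hik', ← hxi]
    · by_cases hak : a = k
      · subst hak; simp [hai, hx'k]
      · simp [hai, hak, hx'a a hai hak]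
  have hsum : ∀ S : Finset (Fin d), i ∈ S → k ∈ S → ∑ a ∈ S, x' a = ∑ a ∈ S, x a :=
    fun S hiS hkS => by
      have h := congrArg (fun f : Fin d → ℝ≥0 => ∑ a ∈ S, f a) hadd
      simpa [Finset.sum_add_distrib, Finset.sum_pi_single', hiS, hkS] using h
  have hdom := dominates_pow_of_transfer hik' hxi hx'k (hyk.trans ((hy hik.le).trans hyi)) hx'a n
  refine hdom.trans (ih _ ?_ ?_ ?_ rfl)
  · rw [← hN]
    refine Finset.card_lt_card ((Finset.ssubset_iff_of_subset fun a ha => ?_).2 ?_)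
    · simp only [Finset.mem_filter, Finset.mem_univ, true_and] at ha ⊢
      by_cases hai : a = i
      · rw [hai]; exact hi.ne'
      · by_cases hak : a = k
        · rw [hak]; exact hk.ne
        · rwa [hx'a a hai hak]
    · rcases min_choice (x i - y i) (y k - x k) with h | h
      · refine ⟨i, by simp [hi.ne'], ?_⟩
        have : x' i = y i := by rw [hx'i, hδ, h, tsub_tsub_cancel_of_le hi.le]
        simp [this]
      · refine ⟨k, by simp [hk.ne], ?_⟩
        have : x' k = y k := by rw [hx'k, hδ, h, add_tsub_cancel_of_le hk.le]
        simp [this]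
  · rw [hsum _ (Finset.mem_univ _) (Finset.mem_univ _), hs]
  · intro l
    -- Prefixes containing `k` contain `i` too and keep their sum; on shorter ones `x'` is at least
    -- `y` pointwise.
    by_cases hl : (k : ℕ) < l
    · rw [hsum]
      · exact hp l
      · simpa using (Fin.lt_def.1 hik).trans hl
      · simpa using hl
    · refine Finset.sum_le_sum fun a ha => ?_
      have hal : (a : ℕ) < l := (Finset.mem_filter.1 ha).2
      have hak : a < k := Fin.lt_def.2 (by omega)
      by_cases hai : a = i
      · rw [hai]; exact hyi
      · rw [← hx'a a hai hak.ne]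
        exact hmin a hak

lemma exists_perm_antitone (x : Fin d → ℝ≥0) : ∃ e : Equiv.Perm (Fin d), Antitone (x ∘ e) :=
  ⟨Fin.revPerm.trans (Tuple.sort x), fun _ _ h => Tuple.monotone_sort x (Fin.rev_le_rev.2 h)⟩

/-- Multinomial laws are monotone for majorization of their parameters. -/
theorem dominates_pow_of_setMajorizes {x y : Fin d → ℝ≥0}
    (h : SetMajorizes (fun i => (x i : ℝ)) fun i => (y i : ℝ)) (n : ℕ) :
    Dominates (linearForm x ^ n) (linearForm y ^ n) := by
  obtain ⟨e, he⟩ := exists_perm_antitone x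
  obtain ⟨f, hf⟩ := exists_perm_antitone y
  have hperm : ∀ (z : Fin d → ℝ≥0) (g : Equiv.Perm (Fin d)),
      linearForm (z ∘ g) ^ n = rename g.symm (linearForm z ^ n) := fun z g => by
    rw [map_pow, rename_linearForm]; rfl
  have h1 : Dominates (linearForm x ^ n) (linearForm (x ∘ e) ^ n) := by
    rw [hperm]; exact Dominates.rename_perm _ _
  have h2 : Dominates (linearForm (y ∘ f) ^ n) (linearForm y ^ n) := by
    have : y = (y ∘ f) ∘ f.symm := by ext; simp
    have h0 := Dominates.rename_perm f.symm.symm (linearForm (y ∘ f) ^ n)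
    rwa [← hperm, ← this] at h0
  have h3 : SetMajorizes (fun i => (x (e i) : ℝ)) fun i => (y (f i) : ℝ) := by
    have ha := SetMajorizes.comp_perm (fun i => (x (e i) : ℝ)) e.symm
    have hb := SetMajorizes.comp_perm (fun i => (y i : ℝ)) f
    simp only [Equiv.apply_symm_apply] at ha
    exact (ha.trans h).trans hb
  refine h1.trans (Dominates.trans (dominates_pow_of_prefix_sums hf ?_ (fun l => ?_) n) h2)
  · refine NNReal.coe_injective ?_
    push_cast
    exact h3.1
  · obtain ⟨T, hT, hle⟩ := h3.2 (Finset.univ.filter fun i : Fin d => (i : ℕ) < l)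
    have hmono : Antitone fun i => (x (e i) : ℝ) := fun a b hab => NNReal.coe_le_coe.2 (he hab)
    have hle' := hle.trans (sum_le_sum_filter_val_lt hmono rfl)
    have hfil : (Finset.univ.filter fun i : Fin d => (i : ℕ) < T.card) =
        Finset.univ.filter fun i : Fin d => (i : ℕ) < l := by
      rw [hT, Fin.card_filter_val_lt]
      ext a
      simp
    rw [hfil] at hle'
    rw [← NNReal.coe_le_coe]
    push_cast
    exact hle'

end Chain

/-! ### Monotone couplings of one round -/

/-- A transport puts no mass on pairs with an endpoint of zero marginal, so nothing is lost by
restricting to the range of `f`. -/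
lemma Transports.comap {A B : Type*} {R : B → B → Prop} {F G : B → ℝ≥0∞} {f : A → B}
    (hf : Function.Injective f) (hF : ∀ b ∉ Set.range f, F b = 0) (hG : ∀ b ∉ Set.range f, G b = 0)
    (h : Transports R F G) : Transports (fun a a' => R (f a) (f a')) (F ∘ f) (G ∘ f) := by
  obtain ⟨γ, h1, h2, h3⟩ := h
  refine ⟨fun a b => γ (f a) (f b), fun a b => h1 _ _, fun a => ?_, fun b => ?_⟩
  · rw [Function.comp_apply, ← h2, hf.tsum_eq (f := fun b => γ (f a) b)]
    intro b hb
    by_contra hr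
    exact hb (ENNReal.tsum_eq_zero.1 ((h3 b).trans (hG b hr)) (f a))
  · rw [Function.comp_apply, ← h3, hf.tsum_eq (f := fun a => γ a (f b))]
    intro a ha
    by_contra hr
    exact ha (ENNReal.tsum_eq_zero.1 ((h2 a).trans (hF a hr)) (f b))

lemma Transports.exists_isCoupling {A : Type*} [Countable A] [MeasurableSpace A]
    [DiscreteMeasurableSpace A] {R : A → A → Prop} {μ ν : Measure A}
    (h : Transports R (fun a => μ {a}) fun a => ν {a}) :
    ∃ Γ : Measure (A × A), IsCoupling Γ μ ν ∧ ∀ᵐ p ∂Γ, R p.1 p.2 := by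
  classical
  obtain ⟨γ, h1, h2, h3⟩ := h
  beta_reduce at h2 h3
  refine ⟨Measure.sum fun p : A × A => γ p.1 p.2 • Measure.dirac p, ⟨?_, ?_⟩, ?_⟩
  · refine Measure.ext_of_singleton fun a => ?_
    rw [Measure.map_apply measurable_fst (measurableSet_singleton a),
      Measure.sum_apply _ (measurable_fst (measurableSet_singleton a)), ENNReal.tsum_prod', ← h2 a,
      tsum_eq_single a]
    · simp
    · intro a' ha'
      simp [ha']
  · refine Measure.ext_of_singleton fun b => ?_
    rw [Measure.map_apply measurable_snd (measurableSet_singleton b),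
      Measure.sum_apply _ (measurable_snd (measurableSet_singleton b)), ENNReal.tsum_prod',
      ENNReal.tsum_comm, ← h3 b, tsum_eq_single b]
    · simp
    · intro b' hb'
      simp [hb']
  · rw [Measure.ae_sum_iff]
    intro p
    by_cases hp : γ p.1 p.2 = 0
    · simp [hp]
    · refine Measure.ae_smul_measure ?_ _
      rw [ae_dirac_iff .of_discrete]
      exact h1 _ _ hp

/-! ### One round as the coefficients of a power -/

section Multinomial

open MvPolynomial
open scoped NNReal

variable {n : ℕ}

/-- A configuration as an exponent vector. -/
noncomputable def Config.toFinsupp (c : Config n) : Fin n →₀ ℕ := Finsupp.equivFunOnFinite.symm c.1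

lemma Config.toFinsupp_injective : Function.Injective (Config.toFinsupp (n := n)) :=
  Finsupp.equivFunOnFinite.symm.injective.comp Subtype.val_injective

/-- Expanding the power chooses a color for each node, so collecting equal monomials mirrors the
pushforward under `Config.ofOpinions`. -/
lemma linearForm_pow_eq_sum (x : Fin n → ℝ≥0) :
    linearForm x ^ n = ∑ o : Fin n → Fin n,
      monomial (Config.ofOpinions o).toFinsupp (∏ v, x (o v)) := by
  rw [linearForm, Fintype.sum_pow]
  refine Finset.sum_congr rfl fun o _ => ?_
  have hexp : (Config.ofOpinions o).toFinsupp = ∑ v, Finsupp.single (o v) 1 := by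
    ext i
    rw [Finsupp.finsetSum_apply]
    change (Finset.univ.filter fun v => o v = i).card = _
    simp only [Finset.card_filter, Finsupp.single_apply]
  rw [hexp, Finset.prod_mul_distrib, ← map_prod, monomial_sum_index]
  rfl

lemma coeff_linearForm_pow_of_notMem_range (x : Fin n → ℝ≥0) {b : Fin n →₀ ℕ}
    (hb : b ∉ Set.range (Config.toFinsupp (n := n))) : (linearForm x ^ n).coeff b = 0 := by
  rw [linearForm_pow_eq_sum, coeff_sum]
  refine Finset.sum_eq_zero fun o _ => ?_
  rw [coeff_monomial, if_neg]
  exact fun h => hb ⟨_, h⟩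

lemma step_apply_singleton (α : ProcessFunction n) (c c' : Config n) :
    α.step c {c'} =
      coeffWeight (linearForm (fun i => (α c i).toNNReal) ^ n) c'.toFinsupp := by
  have hstep : α.step c = (Measure.pi fun _ : Fin n => (α c).toMeasure).map Config.ofOpinions := rfl
  rw [hstep, Measure.map_apply .of_discrete (measurableSet_singleton c'), coeffWeight,
    linearForm_pow_eq_sum, coeff_sum]
  classical
  simp only [coeff_monomial, Config.toFinsupp_injective.eq_iff]
  rw [← Finset.sum_filter, ENNReal.ofNNReal_finsetSum]
  have hset : Config.ofOpinions ⁻¹' {c'} =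
      ((Finset.univ.filter fun o : Fin n → Fin n => Config.ofOpinions o = c' : Finset _) :
        Set (Fin n → Fin n)) := by
    ext o; simp
  rw [hset, ← sum_measure_singleton]
  refine Finset.sum_congr rfl fun o _ => ?_
  rw [Measure.pi_singleton, ENNReal.ofNNReal_finsetProd]
  refine Finset.prod_congr rfl fun v _ => ?_
  rw [PMF.toMeasure_apply_singleton _ _ (measurableSet_singleton _),
    ENNReal.coe_toNNReal (PMF.apply_ne_top _ _)]

/-- Processes whose adoption probabilities majorize each other have majorizing rounds. -/
theorem exists_isCoupling_step (α β : ProcessFunction n) (c c' : Config n)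
    (h : SetMajorizes (α.probVec c) (β.probVec c')) :
    ∃ Γ : Measure (Config n × Config n), IsCoupling Γ (α.step c) (β.step c') ∧
      ∀ᵐ p ∂Γ, SetMajorizes (fun i => (p.1 i : ℝ)) (fun i => (p.2 i : ℝ)) := by
  refine Transports.exists_isCoupling
    (R := fun a b : Config n => SetMajorizes (fun i => (a i : ℝ)) (fun i => (b i : ℝ))) ?_
  simp only [step_apply_singleton]
  refine Transports.comap (Config.toFinsupp_injective (n := n)) (fun b hb => ?_) (fun b hb => ?_)
    (dominates_pow_of_setMajorizes h n)
  · rw [coeffWeight, coeff_linearForm_pow_of_notMem_range _ hb, ENNReal.coe_zero]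
  · rw [coeffWeight, coeff_linearForm_pow_of_notMem_range _ hb, ENNReal.coe_zero]

end Multinomial

/-! ### Couplings of Markov chains -/

section Chains

open Preorder

variable {S T : Type*} [MeasurableSpace S] [MeasurableSpace T]

/-- A transition kernel, as a kernel that reads only the last entry of the history. -/
noncomputable def lastStep (P : Kernel S S) (t : ℕ) : Kernel ((_ : Finset.Iic t) → S) S :=
  P.comap (fun h => h ⟨t, Finset.mem_Iic.2 le_rfl⟩) (measurable_pi_apply _)

instance (P : Kernel S S) [IsMarkovKernel P] (t : ℕ) : IsMarkovKernel (lastStep P t) :=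
  inferInstanceAs (IsMarkovKernel (Kernel.comap _ _ _))

/-- The law of the Markov chain with transition kernel `P` started in `s`. -/
noncomputable def chainLaw (P : Kernel S S) [IsMarkovKernel P] (s : S) : Measure (ℕ → S) :=
  Kernel.traj (X := fun _ => S) (lastStep P) 0 (fun _ => s)

/-- A history extended by one entry. -/
def extendHistory {b : ℕ} (h : (_ : Finset.Iic b) → S) (y : S) : (_ : Finset.Iic (b + 1)) → S :=
  fun i => if hi : (i : ℕ) ≤ b then h ⟨i, Finset.mem_Iic.2 hi⟩ else y

lemma measurable_extendHistory {b : ℕ} (h : (_ : Finset.Iic b) → S) :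
    Measurable (extendHistory h) := by
  refine measurable_pi_lambda _ fun i => ?_
  by_cases hi : (i : ℕ) ≤ b
  · simp [extendHistory, hi]
  · simpa [extendHistory, hi] using measurable_id'

/-- The one-step recursion for laws of finite histories, on which the inductions over time rest. -/
lemma partialTraj_succ_apply' (P : Kernel S S) [IsMarkovKernel P] (b : ℕ)
    (x : (_ : Finset.Iic 0) → S) {A : Set ((_ : Finset.Iic (b + 1)) → S)} (hA : MeasurableSet A) :
    Kernel.partialTraj (X := fun _ => S) (lastStep P) 0 (b + 1) x A =
      ∫⁻ h, P (h ⟨b, Finset.mem_Iic.2 le_rfl⟩) (extendHistory h ⁻¹' A)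
        ∂(Kernel.partialTraj (X := fun _ => S) (lastStep P) 0 b x) := by
  rw [Kernel.partialTraj_succ_of_le (Nat.zero_le b),
    Kernel.map_apply' _ (measurable_IicProdIoc (X := fun _ => S)) _ hA,
    Kernel.comp_apply' _ _ _ (measurable_IicProdIoc (X := fun _ => S) hA)]
  refine lintegral_congr fun h => ?_
  rw [Kernel.prod_apply, Kernel.id_apply, Measure.dirac_prod,
    Measure.map_apply measurable_prodMk_left (measurable_IicProdIoc (X := fun _ => S) hA),
    Kernel.map_apply _ (MeasurableEquiv.piSingleton (X := fun _ => S) b).measurable,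
    Measure.map_apply (MeasurableEquiv.piSingleton (X := fun _ => S) b).measurable
      (measurable_prodMk_left (measurable_IicProdIoc (X := fun _ => S) hA)),
    lastStep, Kernel.comap_apply]
  congr 1
  ext y
  simp only [Set.mem_preimage]
  congr! 1
  ext i
  simp only [IicProdIoc, extendHistory, MeasurableEquiv.piSingleton, MeasurableEquiv.coe_mk,
    Equiv.coe_fn_mk, eq_rec_constant]

lemma map_partialTraj [Countable T] [DiscreteMeasurableSpace T] {Q : Kernel S S}
    {P : Kernel T T} [IsMarkovKernel Q] [IsMarkovKernel P]
    {f : S → T} (hf : Measurable f) (hQ : ∀ s, (Q s).map f = P (f s)) (s : S) (b : ℕ) :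
    (Kernel.partialTraj (X := fun _ => S) (lastStep Q) 0 b fun _ => s).map
        (fun h i => f (h i)) =
      Kernel.partialTraj (X := fun _ => T) (lastStep P) 0 b fun _ => f s := by
  have hm : ∀ b : ℕ, Measurable fun (h : (_ : Finset.Iic b) → S) i => f (h i) := fun b =>
    measurable_pi_lambda _ fun i => hf.comp (measurable_pi_apply i)
  induction b with
  | zero =>
    rw [Kernel.partialTraj_self, Kernel.partialTraj_self, Kernel.id_apply, Kernel.id_apply,
      Measure.map_dirac' (hm 0)]
  | succ b ih =>
    ext A hA
    rw [Measure.map_apply (hm _) hA, partialTraj_succ_apply' _ _ _ (hm _ hA),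
      partialTraj_succ_apply' _ _ _ hA, ← ih]
    rw [lintegral_map']
    · refine lintegral_congr fun h => ?_
      rw [← hQ, Measure.map_apply hf (measurable_extendHistory _ hA)]
      congr 1
      ext y
      simp only [Set.mem_preimage]
      congr! 1
      ext i
      simp only [extendHistory]
      split_ifs <;> rfl
    · exact Measurable.aemeasurable .of_discrete
    · exact (hm b).aemeasurable

/-- The image of a Markov chain under a map that intertwines the transition kernels. -/
lemma map_chainLaw [Countable T] [DiscreteMeasurableSpace T] {Q : Kernel S S}
    {P : Kernel T T} [IsMarkovKernel Q] [IsMarkovKernel P]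
    {f : S → T} (hf : Measurable f) (hQ : ∀ s, (Q s).map f = P (f s)) (s : S) :
    (chainLaw Q s).map (fun p t => f (p t)) = chainLaw P (f s) := by
  have hm : Measurable fun (p : ℕ → S) t => f (p t) :=
    measurable_pi_lambda _ fun i => hf.comp (measurable_pi_apply i)
  have hm' : ∀ b : ℕ, Measurable fun (h : (_ : Finset.Iic b) → S) i => f (h i) := fun b =>
    measurable_pi_lambda _ fun i => hf.comp (measurable_pi_apply i)
  have : ∀ I : Finset ℕ, IsFiniteMeasure (inducedFamily (X := fun _ => T)
      (fun b => Kernel.partialTraj (X := fun _ => T) (lastStep P) 0 b fun _ => f s) I) := by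
    intro I; rw [inducedFamily]; infer_instance
  -- A trajectory law is determined by its finite-history marginals, so it suffices to match those.
  refine ((Kernel.isProjectiveLimit_trajFun (X := fun _ => T) (lastStep P) 0
    fun _ => f s).unique ?_).symm
  rw [isProjectiveLimit_nat_iff' _ _ 0]
  · intro b _
    rw [inducedFamily_Iic, ← map_partialTraj hf hQ, Measure.map_map (measurable_frestrictLe b) hm,
      ← Kernel.traj_map_frestrictLe_apply, Measure.map_map (hm' b) (measurable_frestrictLe b)]
    rfl
  · exact Kernel.isProjectiveMeasureFamily_partialTraj _ _

/-- A property that is preserved by every transition holds at all times. -/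
lemma ae_chainLaw_of_preserved [Countable S] [DiscreteMeasurableSpace S] {Q : Kernel S S}
    [IsMarkovKernel Q] {R : S → Prop}
    (hR : ∀ s, R s → ∀ᵐ s' ∂(Q s), R s') {s : S} (hs : R s) :
    ∀ᵐ p ∂(chainLaw Q s), ∀ t, R (p t) := by
  have key : ∀ b : ℕ, ∀ᵐ h ∂(Kernel.partialTraj (X := fun _ => S) (lastStep Q) 0 b fun _ => s),
      R (h ⟨b, Finset.mem_Iic.2 le_rfl⟩) := by
    intro b
    induction b with
    | zero =>
      rw [Kernel.partialTraj_self, Kernel.id_apply, ae_dirac_iff (by measurability)]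
      exact hs
    | succ b ih =>
      have hA : MeasurableSet {h : (_ : Finset.Iic (b + 1)) → S |
          ¬ R (h ⟨b + 1, Finset.mem_Iic.2 le_rfl⟩)} :=
        measurable_pi_apply (X := fun _ : Finset.Iic (b + 1) => S) _
          (MeasurableSet.of_discrete (s := {s | ¬ R s}))
      rw [ae_iff, partialTraj_succ_apply' _ _ _ hA, lintegral_eq_zero_iff']
      · filter_upwards [ih] with h hh
        have := ae_iff.1 (hR _ hh)
        simpa [extendHistory] using this
      · exact Measurable.aemeasurable .of_discrete
  rw [ae_all_iff]
  intro t
  have h := key t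
  rw [← Kernel.traj_map_frestrictLe_apply] at h
  exact ae_of_ae_map (measurable_frestrictLe t).aemeasurable h

end Chains

/-! ### Voter, 3-Majority and their coupling -/

variable {n : ℕ}

lemma voter_probVec [NeZero n] (c : Config n) :
    voter.probVec c = fun i => (n : ℝ)⁻¹ * (c i : ℝ) := by
  ext i
  simp [ProcessFunction.probVec, voter, div_eq_inv_mul]

lemma sum_voter_probVec [NeZero n] (c : Config n) : ∑ i, voter.probVec c i = 1 := by
  rw [voter_probVec, ← Finset.mul_sum, ← Nat.cast_sum, c.2]
  exact inv_mul_cancel₀ (Nat.cast_ne_zero.2 (NeZero.ne n))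

lemma toReal_bind_apply {A B : Type*} [Fintype A] (p : PMF A) (f : A → PMF B) (b : B) :
    (p.bind f b).toReal = ∑ a, (p a).toReal * (f a b).toReal := by
  rw [PMF.bind_apply, tsum_fintype, ENNReal.toReal_sum]
  · simp only [ENNReal.toReal_mul]
  · exact fun a _ => ENNReal.mul_ne_top (PMF.apply_ne_top _ _) (PMF.apply_ne_top _ _)

/-- Start from the average of the three indicators; each agreeing pair takes over the share of the
third sample. If all three agree, the corrections vanish. This form can be summed one sample at a
time. -/
lemma toReal_majorityRule (a₁ a₂ a₃ i : Fin n) :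
    (majorityRule a₁ a₂ a₃ i).toReal =
      ((if a₁ = i then 1 else 0) + (if a₂ = i then 1 else 0) + (if a₃ = i then 1 else 0) +
        (if a₁ = a₂ then (if a₁ = i then 1 else 0) - (if a₃ = i then 1 else 0) else 0) +
        (if a₁ = a₃ then (if a₁ = i then 1 else 0) - (if a₂ = i then 1 else 0) else 0) +
        (if a₂ = a₃ then (if a₂ = i then 1 else 0) - (if a₁ = i then 1 else 0) else 0)) / 3 := by
  unfold majorityRule
  by_cases h12 : a₁ = a₂
  · subst h12
    by_cases h13 : a₁ = a₃
    · subst h13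
      by_cases h1 : a₁ = i
      · subst h1; norm_num
      · simp [h1, Ne.symm h1]
    · by_cases h1 : a₁ = i
      · subst h1; norm_num [h13]
      · simp [h1, h13, Ne.symm h1]
  · by_cases h13 : a₁ = a₃
    · subst h13
      by_cases h1 : a₁ = i
      · subst h1; norm_num [h12, Ne.symm h12]
      · simp [h1, h12, Ne.symm h12, Ne.symm h1]
    · by_cases h23 : a₂ = a₃
      · subst h23
        by_cases h2 : a₂ = i
        · subst h2; norm_num [h12]
        · simp [h2, h12, Ne.symm h2]
      · have hcard : ({a₁, a₂, a₃} : Finset (Fin n)).card = 3 :=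
          Finset.card_eq_three.2 ⟨a₁, a₂, a₃, h12, h13, h23, rfl⟩
        rw [if_neg (by simp [h12, h13]), if_neg h23, PMF.uniformOfFinset_apply, hcard]
        simp only [Finset.mem_insert, Finset.mem_singleton, h12, h13, h23, if_false]
        by_cases h1 : a₁ = i
        · subst h1; simp [Ne.symm h12, Ne.symm h13]
        · by_cases h2 : a₂ = i
          · subst h2; simp [h12, Ne.symm h12, Ne.symm h23]
          · by_cases h3 : a₃ = i
            · subst h3; simp [h13, h23]
            · simp [h1, h2, h3, Ne.symm h1, Ne.symm h2, Ne.symm h3]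

lemma threeMajority_probVec [NeZero n] (c : Config n) :
    threeMajority.probVec c = fun i => voter.probVec c i *
      (1 + voter.probVec c i - ∑ j, voter.probVec c j ^ 2) := by
  ext i
  have hs := sum_voter_probVec c
  set x := voter.probVec c with hx
  have hx' : ∀ a, (voter c a).toReal = x a := fun _ => rfl
  simp only [ProcessFunction.probVec, threeMajority, toReal_bind_apply, toReal_majorityRule, hx']
  set s := ∑ j, x j ^ 2 with hsq
  have hind : ∑ a, x a * (if a = i then (1 : ℝ) else 0) = x i := by simp
  have hmul : ∀ u : ℝ, ∑ a, x a * u = u := fun u => by rw [← Finset.sum_mul, hs, one_mul]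
  have hsq_ind : ∑ a, x a * (x a * (if a = i then (1 : ℝ) else 0)) = x i ^ 2 := by simp [sq]
  have hsq_mul : ∀ u : ℝ, ∑ a, x a * (x a * u) = s * u := fun u => by
    rw [hsq, Finset.sum_mul]
    exact Finset.sum_congr rfl fun a _ => by ring
  have hdiag : ∀ (a : Fin n) (f : Fin n → ℝ), ∑ b, x b * (if a = b then f b else 0) = x a * f a :=
    fun a f => by simp
  have hinner : ∀ a b, ∑ a₃, x a₃ *
      (((if a = i then 1 else 0) + (if b = i then 1 else 0) + (if a₃ = i then 1 else 0) +
        (if a = b then (if a = i then 1 else 0) - (if a₃ = i then 1 else 0) else 0) +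
        (if a = a₃ then (if a = i then 1 else 0) - (if b = i then 1 else 0) else 0) +
        (if b = a₃ then (if b = i then 1 else 0) - (if a = i then 1 else 0) else 0)) / 3) =
      ((if a = i then 1 else 0) + (if b = i then 1 else 0) + x i +
        (if a = b then (if b = i then 1 else 0) - x i else 0) +
        x a * ((if a = i then 1 else 0) - (if b = i then 1 else 0)) +
        x b * ((if b = i then 1 else 0) - (if a = i then 1 else 0))) / 3 := fun a b => by
    simp only [mul_div_assoc', ← Finset.sum_div, mul_add, Finset.sum_add_distrib, hmul, hind]
    rw [hdiag a fun _ => _, hdiag b fun _ => _]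
    congr 4
    by_cases h : a = b
    · subst h; simp [mul_sub, Finset.sum_sub_distrib, hs]
    · simp [h]
  have hmiddle : ∀ a, ∑ b, x b *
      (((if a = i then 1 else 0) + (if b = i then 1 else 0) + x i +
        (if a = b then (if b = i then 1 else 0) - x i else 0) +
        x a * ((if a = i then 1 else 0) - (if b = i then 1 else 0)) +
        x b * ((if b = i then 1 else 0) - (if a = i then 1 else 0))) / 3) =
      ((if a = i then 1 else 0) + 2 * x i + 2 * (x a * ((if a = i then 1 else 0) - x i)) +
        (x i ^ 2 - s * (if a = i then 1 else 0))) / 3 := fun a => by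
    simp only [mul_div_assoc', ← Finset.sum_div, mul_add, mul_sub, Finset.sum_add_distrib,
      Finset.sum_sub_distrib, hmul, hind, hsq_ind, hsq_mul]
    rw [hdiag a fun b => (if b = i then 1 else 0) - x i]
    simp only [mul_left_comm _ (x a), ← Finset.mul_sum, hind]
    ring
  have houter : ∀ a, x a *
      (((if a = i then 1 else 0) + 2 * x i + 2 * (x a * ((if a = i then 1 else 0) - x i)) +
        (x i ^ 2 - s * (if a = i then 1 else 0))) / 3) =
      ((1 - s) * (x a * (if a = i then 1 else 0)) + x a * (2 * x i + x i ^ 2) +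
        2 * (x a * (x a * (if a = i then 1 else 0))) - x a * (x a * (2 * x i))) / 3 := fun a => by
    ring
  simp only [hinner, hmiddle, houter]
  rw [← Finset.sum_div, Finset.sum_sub_distrib, Finset.sum_add_distrib, Finset.sum_add_distrib,
    ← Finset.mul_sum, ← Finset.mul_sum, hind, hmul, hsq_ind, hsq_mul]
  ring

theorem threeMajority_setMajorizes_voter [NeZero n] (c : Config n) :
    SetMajorizes (threeMajority.probVec c) (voter.probVec c) := by
  rw [threeMajority_probVec]
  exact setMajorizes_mul_add_sub (fun _ => ENNReal.toReal_nonneg) (sum_voter_probVec c)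

theorem threeMajority_setMajorizes_voter_of_setMajorizes [NeZero n] {c c' : Config n}
    (h : SetMajorizes (fun i => (c i : ℝ)) (fun i => (c' i : ℝ))) :
    SetMajorizes (threeMajority.probVec c) (voter.probVec c') := by
  refine (threeMajority_setMajorizes_voter c).trans ?_
  rw [voter_probVec, voter_probVec]
  exact h.const_mul (by positivity)

/-- If the adoption probabilities of `α` majorize those of `β` whenever the configurations do,
then the two processes can be coupled such that majorization is preserved forever. -/
theorem exists_isCoupling_law {α β : ProcessFunction n}
    (h : ∀ c c' : Config n, SetMajorizes (fun i => (c i : ℝ)) (fun i => (c' i : ℝ)) →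
      SetMajorizes (α.probVec c) (β.probVec c')) (c : Config n) :
    ∃ Γ : Measure ((ℕ → Config n) × (ℕ → Config n)), IsCoupling Γ (β.law c) (α.law c) ∧
      ∀ᵐ p ∂Γ, ∀ t : ℕ, SetMajorizes (fun i => (p.2 t i : ℝ)) (fun i => (p.1 t i : ℝ)) := by
  have hex : ∀ s : Config n × Config n, ∃ Γ : Measure (Config n × Config n),
      IsCoupling Γ (α.step s.1) (β.step s.2) ∧
        (SetMajorizes (fun i => (s.1 i : ℝ)) (fun i => (s.2 i : ℝ)) →
          ∀ᵐ p ∂Γ, SetMajorizes (fun i => (p.1 i : ℝ)) (fun i => (p.2 i : ℝ))) := fun s => by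
    by_cases hs : SetMajorizes (fun i => (s.1 i : ℝ)) (fun i => (s.2 i : ℝ))
    · obtain ⟨Γ, h1, h2⟩ := exists_isCoupling_step α β s.1 s.2 (h _ _ hs)
      exact ⟨Γ, h1, fun _ => h2⟩
    -- Pairs outside the relation still need a kernel with the right marginals; the independent
    -- coupling serves.
    · exact ⟨(α.step s.1).prod (β.step s.2), ⟨by simp [Measure.map_fst_prod],
        by simp [Measure.map_snd_prod]⟩, fun h => absurd h hs⟩
  choose Γ hΓ hR using hex
  let Q : Kernel (Config n × Config n) (Config n × Config n) := Kernel.ofFunOfCountable Γ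
  have hQ : IsMarkovKernel Q := ⟨fun s => ⟨by
    have h1 := congrArg (fun μ => μ Set.univ) (hΓ s).1
    change Γ s Set.univ = 1
    simpa [Measure.map_apply measurable_fst MeasurableSet.univ] using h1⟩⟩
  have h1 := map_chainLaw (Q := Q) (P := α.step) measurable_fst (fun s => (hΓ s).1) (c, c)
  have h2 := map_chainLaw (Q := Q) (P := β.step) measurable_snd (fun s => (hΓ s).2) (c, c)
  have hm1 : Measurable fun (p : ℕ → Config n × Config n) t => (p t).1 :=
    measurable_pi_lambda _ fun t => measurable_fst.comp (measurable_pi_apply t)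
  have hm2 : Measurable fun (p : ℕ → Config n × Config n) t => (p t).2 :=
    measurable_pi_lambda _ fun t => measurable_snd.comp (measurable_pi_apply t)
  have hm : Measurable fun (p : ℕ → Config n × Config n) =>
      ((fun t => (p t).2, fun t => (p t).1) : (ℕ → Config n) × (ℕ → Config n)) := hm2.prodMk hm1
  refine ⟨(chainLaw Q (c, c)).map fun p => (fun t => (p t).2, fun t => (p t).1), ⟨?_, ?_⟩, ?_⟩
  · rw [Measure.map_map measurable_fst hm]
    -- `chainLaw β.step` and `β.law` agree by unfolding definitions.
    exact h2
  · rw [Measure.map_map measurable_snd hm]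
    exact h1
  · have hae := ae_chainLaw_of_preserved (Q := Q)
      (R := fun s => SetMajorizes (fun i => (s.1 i : ℝ)) (fun i => (s.2 i : ℝ)))
      (fun s => hR s) (s := (c, c)) (SetMajorizes.refl fun i => (c i : ℝ))
    rw [ae_map_iff hm.aemeasurable]
    · exact hae
    · have hset : {p : (ℕ → Config n) × (ℕ → Config n) | ∀ t : ℕ,
          SetMajorizes (fun i => (p.2 t i : ℝ)) (fun i => (p.1 t i : ℝ))} =
          ⋂ t, (fun p : (ℕ → Config n) × (ℕ → Config n) => (p.2 t, p.1 t)) ⁻¹'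
            {s | SetMajorizes (fun i => (s.1 i : ℝ)) (fun i => (s.2 i : ℝ))} := by
        ext p; simp
      rw [hset]
      exact MeasurableSet.iInter fun t =>
        (((measurable_pi_apply t).comp measurable_snd).prodMk
          ((measurable_pi_apply t).comp measurable_fst)) .of_discrete

lemma le_hitTime_iff {κ x : ℕ} {p : ℕ → Config n} :
    (x : ℕ∞) ≤ hitTime κ p ↔ ∀ t < x, κ < (p t).numColors := by
  simp only [hitTime, le_iInf_iff, Nat.cast_le]
  exact forall_congr' fun t => by
    rw [← not_imp_not, not_le, not_le]

lemma measurableSet_le_hitTime (κ x : ℕ) :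
    MeasurableSet {p : ℕ → Config n | (x : ℕ∞) ≤ hitTime κ p} := by
  have hset : {p : ℕ → Config n | (x : ℕ∞) ≤ hitTime κ p} =
      ⋂ t, ⋂ _ : t < x, (fun p : ℕ → Config n => p t) ⁻¹' {c | κ < c.numColors} := by
    ext p; simp [le_hitTime_iff]
  rw [hset]
  exact MeasurableSet.iInter fun t => MeasurableSet.iInter fun _ =>
    measurable_pi_apply t .of_discrete

end Consensus

theorem mainTheorem5 (n : ℕ) [NeZero n] :
    (∀ c : Consensus.Config n,
      (∃ γ : Measure ((ℕ → Consensus.Config n) × (ℕ → Consensus.Config n)),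
        Consensus.IsCoupling γ (Consensus.voter.law c) (Consensus.threeMajority.law c) ∧
        ∀ᵐ p ∂γ, ∀ t : ℕ, (p.2 t).numColors ≤ (p.1 t).numColors) ∧
      (∀ κ : ℕ, 1 ≤ κ →
        Consensus.StochLE
          (Consensus.threeMajority.law c) (Consensus.hitTime κ)
          (Consensus.voter.law c) (Consensus.hitTime κ))) ∧
    (∀ c c' : Consensus.Config n,
      Consensus.Majorizes (fun i => (c i : ℝ)) (fun i => (c' i : ℝ)) →
      Consensus.Majorizes
        (Consensus.threeMajority.probVec c) (Consensus.voter.probVec c')) := by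
  refine ⟨fun c => ?_, fun c c' h => ?_⟩
  · obtain ⟨γ, hγ, hae⟩ := Consensus.exists_isCoupling_law
      (α := Consensus.threeMajority) (β := Consensus.voter)
      (fun _ _ => Consensus.threeMajority_setMajorizes_voter_of_setMajorizes) c
    have hnum : ∀ᵐ p ∂γ, ∀ t : ℕ, (p.2 t).numColors ≤ (p.1 t).numColors := by
      filter_upwards [hae] with p hp t
      exact Consensus.Config.numColors_le_of_setMajorizes (hp t)
    refine ⟨⟨γ, hγ, hnum⟩, fun κ _ x => ?_⟩
    have hx := Consensus.measurableSet_le_hitTime (n := n) κ x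
    -- Both tail events are pulled back to the coupling space, where one contains the other almost
    -- surely.
    rw [← hγ.1, ← hγ.2, Measure.map_apply measurable_snd hx, Measure.map_apply measurable_fst hx]
    refine measure_mono_ae ?_
    filter_upwards [hnum] with p hp h
    exact Consensus.le_hitTime_iff.2 fun t ht =>
      (Consensus.le_hitTime_iff.1 h t ht).trans_le (hp t)
  · rw [Consensus.majorizes_iff_setMajorizes] at h ⊢
    exact Consensus.threeMajority_setMajorizes_voter_of_setMajorizes h
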